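/- Let $X$ be a geodesic Gromov hyperbolic metric space, not assumed proper, and let $H$ be a group acting on $X$ by isometries (the action need not be proper). Let $\partial_\infty X$ denote the Gromov boundary of $X$: the set of equivalence classes of sequences $(x_n)$ in $X$ with $(x_i\mid x_j)_o\to\infty$ as $i,j\to\infty$, where $(x_n)$ and $(y_n)$ are equivalent if $(x_i\mid y_j)_o\to\infty$ as $i,j\to\infty$; here $(x\mid y)_o=\tfrac12\big(d(x,o)+d(y,o)-d(x,y)\big)$ and the choice of base point $o$ does not matter. The group $H$ acts on $\partial_\infty X$. An element $h\in H$ is called loxodromic if, for some point $x\in X$ (equivalently, $X\neq\emptyset$ and for every $x\in X$), the map $\mathbb{Z}\to X$, $n\mapsto h^n x$, is a quasi-isometric embedding. **Proposition.** Assume that $H$ contains a normal subgroup $K$ which is isomorphic to a direct product $\prod_{i=1}^k K_i$ of finitely many groups, and identify each $K_i$ and each subproduct with its image in $K\subseteq H$. 1. For every $j\in\{1,\dots,k\}$, if $K_j$ contains a loxodromic element, then the subgroup $\prod_{i\neq j}K_i$ has a finite orbit in $\partial_\infty X$, that is, there is $\xi\in\partial_\infty X$ whose orbit under this subgroup is finite.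 2. If no $K_j$ contains a loxodromic element, then either $K$ has a finite orbit in $\partial_\infty X$, or $H$ has bounded orbits in $X$, that is, for every $x\in X$ the orbit $H\cdot x$ has finite diameter. -/

import Mathlib

open Filter

noncomputable section

namespace GromovHyp

/-- A metric space is geodesic if any two points are joined by a geodesic segment. -/
def IsGeodesicSpace (X : Type*) [MetricSpace X] : Prop :=
  ∀ x y : X, ∃ γ : ℝ → X, γ 0 = x ∧ γ (dist x y) = y ∧
    ∀ s ∈ Set.Icc 0 (dist x y), ∀ t ∈ Set.Icc 0 (dist x y), dist (γ s) (γ t) = |s - t|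

/-- The Gromov product `(x | y)_o`. -/
def gromovProduct {X : Type*} [MetricSpace X] (o x y : X) : ℝ :=
  (dist x o + dist y o - dist x y) / 2

/-- Gromov hyperbolicity: `(x | z)_o ≥ min ((x | y)_o) ((y | z)_o) - δ` for some uniform `δ`. -/
class GromovHyperbolic (X : Type*) [MetricSpace X] : Prop where
  exists_delta : ∃ δ : ℝ, ∀ o x y z : X,
    min (gromovProduct o x y) (gromovProduct o y z) - δ ≤ gromovProduct o x z

section Boundary

variable {X : Type*} [MetricSpace X]

/-- `(x_i | y_j)_o → ∞` as `i, j → ∞`, for every base point `o` (changing the base point changes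
the Gromov product by a bounded amount, so one base point would do). -/
def CloseAtInfinity (x y : ℕ → X) : Prop :=
  ∀ o : X, Tendsto (fun p : ℕ × ℕ => gromovProduct o (x p.1) (y p.2)) atTop atTop

variable (X) in
/-- Sequences converging to infinity, i.e. with `(x_i | x_j)_o → ∞` as `i, j → ∞`. -/
def SeqToInfinity : Type _ := {x : ℕ → X // CloseAtInfinity x x}

lemma gromovProduct_comm (o x y : X) : gromovProduct o x y = gromovProduct o y x := by
  unfold gromovProduct
  rw [dist_comm x y]
  ring

lemma CloseAtInfinity.symm {x y : ℕ → X} (h : CloseAtInfinity x y) : CloseAtInfinity y x := by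
  intro o
  rw [tendsto_atTop]
  intro M
  have h1 := (tendsto_atTop.1 (h o)) M
  rw [eventually_atTop] at h1 ⊢
  obtain ⟨⟨a, b⟩, hab⟩ := h1
  refine ⟨(b, a), fun p hp => ?_⟩
  rw [gromovProduct_comm]
  exact hab (p.2, p.1) ⟨hp.2, hp.1⟩

lemma CloseAtInfinity.trans [GromovHyperbolic X] {x y z : ℕ → X}
    (h : CloseAtInfinity x y) (h' : CloseAtInfinity y z) : CloseAtInfinity x z := by
  obtain ⟨δ, hδ⟩ := GromovHyperbolic.exists_delta (X := X)
  intro o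
  rw [tendsto_atTop]
  intro M
  have h1 := (tendsto_atTop.1 (h o)) (M + δ)
  have h2 := (tendsto_atTop.1 (h' o)) (M + δ)
  rw [eventually_atTop] at h1 h2 ⊢
  obtain ⟨⟨a, b⟩, hab⟩ := h1
  obtain ⟨⟨c, d⟩, hcd⟩ := h2
  refine ⟨(a, d), fun p hp => ?_⟩
  have e1 := hab (p.1, max b c) ⟨hp.1, le_max_left _ _⟩
  have e2 := hcd (max b c, p.2) ⟨le_max_right _ _, hp.2⟩
  have e3 := hδ o (x p.1) (y (max b c)) (z p.2)
  have e4 := le_min e1 e2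
  simp only at e4
  linarith

instance boundarySetoid (X : Type*) [MetricSpace X] [GromovHyperbolic X] :
    Setoid (SeqToInfinity X) where
  r x y := CloseAtInfinity x.1 y.1
  iseqv := ⟨fun x => x.2, fun h => h.symm, fun h h' => h.trans h'⟩

/-- The (sequential) Gromov boundary: sequences converging to infinity, two of them being
identified when `(x_i | y_j)_o → ∞`. -/
def Boundary (X : Type*) [MetricSpace X] [GromovHyperbolic X] : Type _ :=
  Quotient (boundarySetoid X)

end Boundary

section Action

variable {H : Type*} [Group H] {X : Type*} [MetricSpace X] [MulAction H X] [IsIsometricSMul H X]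

lemma CloseAtInfinity.smul (h : H) {x y : ℕ → X} (hxy : CloseAtInfinity x y) :
    CloseAtInfinity (fun n => h • x n) (fun n => h • y n) := by
  intro o
  have key : ∀ u v : X, gromovProduct o (h • u) (h • v) = gromovProduct (h⁻¹ • o) u v := by
    intro u v
    have e : ∀ w : X, dist (h • w) o = dist w (h⁻¹ • o) := fun w => by
      rw [← dist_smul h w (h⁻¹ • o), smul_inv_smul]
    simp only [gromovProduct, e, dist_smul]
  simpa only [key] using hxy (h⁻¹ • o)

/-- The action on the Gromov boundary induced by an isometric action on the space. -/
instance boundaryAction (H : Type*) [Group H] (X : Type*) [MetricSpace X] [GromovHyperbolic X]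
    [MulAction H X] [IsIsometricSMul H X] : MulAction H (Boundary X) where
  smul h := Quotient.map
    (fun x : SeqToInfinity X => (⟨fun n => h • x.1 n, x.2.smul h⟩ : SeqToInfinity X))
    (fun _ _ hxy => CloseAtInfinity.smul h hxy)
  one_smul ξ := by
    induction ξ using Quotient.inductionOn with
    | h x => exact congrArg (Quotient.mk _) (Subtype.ext (funext fun n => one_smul H (x.1 n)))
  mul_smul g h ξ := by
    induction ξ using Quotient.inductionOn with
    | h x => exact congrArg (Quotient.mk _) (Subtype.ext (funext fun n => mul_smul g h (x.1 n)))

end Action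

/-- The subgroup `L` of `H` has a finite (hence nonempty) orbit in the Gromov boundary of `X`. -/
def HasFiniteOrbitAtInfinity {H : Type*} [Group H] (L : Subgroup H) (X : Type*) [MetricSpace X]
    [GromovHyperbolic X] [MulAction H X] [IsIsometricSMul H X] : Prop :=
  ∃ ξ : Boundary X, (MulAction.orbit L ξ).Finite

/-- Every orbit of `H` in `X` is bounded, i.e. has finite diameter. -/
def HasBoundedOrbits (H : Type*) [Group H] (X : Type*) [MetricSpace X] [MulAction H X] : Prop :=
  ∀ x : X, Bornology.IsBounded (MulAction.orbit H x)

/-- `h` acts on `X` as a loxodromic isometry: the orbit map `n ↦ h ^ n • x` is a quasi-isometric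
embedding of `ℤ` (for one point `x`, equivalently for all points `x` of the nonempty space). -/
def IsLoxodromic {H : Type*} [Group H] (X : Type*) [MetricSpace X] [MulAction H X] (h : H) : Prop :=
  ∃ x : X, ∃ L : ℝ, 1 ≤ L ∧ ∃ C : ℝ, 0 ≤ C ∧ ∀ m n : ℤ,
    L⁻¹ * |(m : ℝ) - n| - C ≤ dist (h ^ m • x) (h ^ n • x) ∧
      dist (h ^ m • x) (h ^ n • x) ≤ L * |(m : ℝ) - n| + C

/-- Given an isomorphism `e` from `∏ i, G i` onto a subgroup `K` of `H`, the subgroup of `H`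
corresponding to the subproduct `∏ i ∈ S, G i`, i.e. the image under `e` of all families that are
trivial outside `S`. -/
def subproduct {H : Type*} [Group H] {K : Subgroup H} {ι : Type*} {G : ι → Type*}
    [∀ i, Group (G i)] (e : (∀ i, G i) ≃* K) (S : Set ι) : Subgroup H :=
  (Subgroup.pi Sᶜ fun i => (⊥ : Subgroup (G i))).map (K.subtype.comp e.toMonoidHom)

end GromovHyp

end

/-!
The whole argument rests on one estimate. Write `|g| = d(x, g x)`. The four-point inequality shows
that `|g ^ 2| ≥ |g| + 2δ + 1` forces `|g ^ (n + 1)| ≥ |g ^ n| + 1` for all `n`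
(`GromovHyp.dist_pow_smul_step`); such a `g` is loxodromic and `g ^ n x` converges to a boundary
point. Conversely every loxodromic element has a power with this property, because otherwise
`|g ^ (2 ^ n)|` would grow only linearly in `n`.

Hence, if a group contains no loxodromic element, then `(g x | g⁻¹ x)_x ≥ |g| / 2 - const` for each
of its elements. Applying this to `g`, `h` and `g h` shows that `(g x | h x)_x` is large as soon as
`|g|` and `|h|` are (`GromovHyp.le_gromovProduct_of_no_loxodromic`). So when the orbit of `x` is
unbounded, the points `g x` with `|g| → ∞` converge to a single boundary point, and this point is
fixed by the whole group.

Finally, an isometry moving the points of a sequence by a bounded amount fixes the limit of that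
sequence (`GromovHyp.smul_boundaryLimit_eq_of_dist_le`). This applies to an element commuting with
all `g n`, for a sequence `g n • x`, and it applies to each element of a normal subgroup with
bounded orbits, for any sequence in a single `H`-orbit. If `K j` contains a loxodromic element, the
other factors fix its attracting point. If no factor contains a loxodromic element and some `K j`
has unbounded orbits, then its limit point is fixed by `K j` and by the other factors. If all `K j`
have bounded orbits, so has `K`; if then `H` has an unbounded orbit, this orbit accumulates at a
boundary point, which `K` fixes.
-/

namespace GromovHyp

/-! ### The four-point inequality and convergence to infinity -/

section Hyperbolicity

variable {X : Type*} [MetricSpace X]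

/-- `δ` is a nonnegative hyperbolicity constant of `X`, valid at every base point. -/
def IsHyperbolicityConstant (X : Type*) [MetricSpace X] (δ : ℝ) : Prop :=
  0 ≤ δ ∧ ∀ o x y z : X,
    min (gromovProduct o x y) (gromovProduct o y z) - δ ≤ gromovProduct o x z

lemma exists_isHyperbolicityConstant (X : Type*) [MetricSpace X] [GromovHyperbolic X] :
    ∃ δ, IsHyperbolicityConstant X δ := by
  obtain ⟨δ, hδ⟩ := GromovHyperbolic.exists_delta (X := X)
  refine ⟨max δ 0, le_max_right _ _, fun o x y z => ?_⟩
  linarith [hδ o x y z, le_max_left δ 0]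

lemma IsHyperbolicityConstant.four_point {δ : ℝ} (hδ : IsHyperbolicityConstant X δ)
    (x y z t : X) :
    dist x z + dist y t ≤ max (dist x y + dist z t) (dist x t + dist y z) + 2 * δ := by
  have h := hδ.2 t x y z
  simp only [gromovProduct] at h
  rcases min_choice ((dist x t + dist y t - dist x y) / 2)
    ((dist y t + dist z t - dist y z) / 2) with h' | h' <;> rw [h'] at h
  · linarith [le_max_left (dist x y + dist z t) (dist x t + dist y z)]
  · linarith [le_max_right (dist x y + dist z t) (dist x t + dist y z)]

/-- The Gromov product is `1`-Lipschitz in the base point. -/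
lemma gromovProduct_base_le (o o' x y : X) :
    gromovProduct o x y - dist o o' ≤ gromovProduct o' x y := by
  simp only [gromovProduct]
  linarith [dist_triangle x o' o, dist_triangle y o' o, dist_comm o o']

lemma closeAtInfinity_of_base {u v : ℕ → X} (o : X)
    (h : ∀ M : ℝ, ∃ N : ℕ, ∀ m n, N ≤ m → N ≤ n → M ≤ gromovProduct o (u m) (v n)) :
    CloseAtInfinity u v := by
  intro o'
  rw [tendsto_atTop]
  intro M
  obtain ⟨N, hN⟩ := h (M + dist o o')
  filter_upwards [eventually_ge_atTop (N, N)] with p hp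
  linarith [hN p.1 p.2 hp.1 hp.2, gromovProduct_base_le o o' (u p.1) (v p.2)]

end Hyperbolicity

/-! ### Displacements and fixed boundary points -/

section Isometries

variable {H : Type*} [Group H] {X : Type*} [MetricSpace X] [MulAction H X] [IsIsometricSMul H X]

lemma dist_smul_smul_eq (g h : H) (x : X) : dist (g • x) (h • x) = dist x ((g⁻¹ * h) • x) := by
  rw [← dist_smul g x, mul_smul, smul_inv_smul]

lemma dist_inv_smul (g : H) (x : X) : dist x (g⁻¹ • x) = dist x (g • x) := by
  rw [← dist_smul g x (g⁻¹ • x), smul_inv_smul, dist_comm]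

lemma dist_mul_smul_le (g h : H) (x : X) :
    dist x ((g * h) • x) ≤ dist x (g • x) + dist x (h • x) := by
  rw [mul_smul, ← dist_smul g x (h • x)]
  exact dist_triangle _ _ _

lemma dist_pow_smul_le (g : H) (x : X) (n : ℕ) :
    dist x (g ^ n • x) ≤ n * dist x (g • x) := by
  induction n with
  | zero => simp
  | succ n ih =>
    rw [pow_succ]
    push_cast
    linarith [dist_mul_smul_le (g ^ n) g x]

lemma gromovProduct_smul_smul (g h : H) (x : X) :
    gromovProduct x (g • x) (h • x) =
      (dist x (g • x) + dist x (h • x) - dist x ((g⁻¹ * h) • x)) / 2 := by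
  rw [gromovProduct, dist_smul_smul_eq, dist_comm _ x, dist_comm _ x]

/-- The boundary point represented by a sequence converging to infinity. -/
def boundaryLimit [GromovHyperbolic X] {u : ℕ → X} (hu : CloseAtInfinity u u) : Boundary X :=
  Quotient.mk (boundarySetoid X) (⟨u, hu⟩ : SeqToInfinity X)

lemma smul_boundaryLimit_eq [GromovHyperbolic X] {u : ℕ → X} (hu : CloseAtInfinity u u) {f : H}
    (h : CloseAtInfinity (fun n => f • u n) u) : f • boundaryLimit hu = boundaryLimit hu :=
  Quotient.sound (s := boundarySetoid X) (a := (⟨_, hu.smul f⟩ : SeqToInfinity X)) h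

/-- An isometry moving the points of a sequence by a bounded amount fixes its limit. -/
lemma smul_boundaryLimit_eq_of_dist_le [GromovHyperbolic X] {u : ℕ → X}
    (hu : CloseAtInfinity u u) (f : H) {D : ℝ} (hf : ∀ n, dist (f • u n) (u n) ≤ D) :
    f • boundaryLimit hu = boundaryLimit hu := by
  refine smul_boundaryLimit_eq hu fun o => ?_
  refine tendsto_atTop_mono (fun p => ?_) (tendsto_atTop_add_const_right _ (-D) (hu o))
  have h1 := hf p.1
  simp only [gromovProduct]
  linarith [dist_triangle (f • u p.1) (u p.1) (u p.2),
    dist_triangle (u p.1) (f • u p.1) o, dist_comm (u p.1) (f • u p.1)]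

/-- An isometry commuting with all `g n` fixes the limit of `g n • x`. -/
lemma smul_boundaryLimit_eq_of_commute [GromovHyperbolic X] {g : ℕ → H} {x : X}
    (hg : CloseAtInfinity (fun n => g n • x) (fun n => g n • x)) {f : H}
    (hf : ∀ n, Commute f (g n)) :
    f • boundaryLimit hg = boundaryLimit hg := by
  refine smul_boundaryLimit_eq_of_dist_le _ f (D := dist (f • x) x) fun n => ?_
  rw [smul_smul, (hf n).eq, mul_smul, dist_smul]

lemma HasFiniteOrbitAtInfinity.of_fixed [GromovHyperbolic X] {L : Subgroup H} (ξ : Boundary X)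
    (h : ∀ f ∈ L, f • ξ = ξ) : HasFiniteOrbitAtInfinity L X := by
  refine ⟨ξ, (Set.finite_singleton ξ).subset ?_⟩
  rintro _ ⟨f, rfl⟩
  exact h f f.2

/-! ### Loxodromic isometries -/

lemma dist_pow_smul_step {δ : ℝ} (hδ : IsHyperbolicityConstant X δ) {g : H} {x : X}
    (hg : dist x (g • x) + 2 * δ + 1 ≤ dist x (g ^ 2 • x)) (n : ℕ) :
    dist x (g ^ n • x) + 1 ≤ dist x (g ^ (n + 1) • x) := by
  have h0 := hδ.1
  induction n with
  | zero =>
    have := dist_pow_smul_le g x 2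
    push_cast at this
    simp only [pow_zero, one_smul, dist_self, zero_add, pow_one]
    linarith
  | succ n ih =>
    -- the four-point inequality for `x, g x, g² x, gⁿ⁺² x`
    have h := hδ.four_point x (g • x) (g ^ 2 • x) (g ^ (n + 2) • x)
    have e1 : dist (g • x) (g ^ (n + 2) • x) = dist x (g ^ (n + 1) • x) := by
      rw [dist_smul_smul_eq]; congr 2; group
    have e2 : dist (g ^ 2 • x) (g ^ (n + 2) • x) = dist x (g ^ n • x) := by
      rw [dist_smul_smul_eq]; congr 2; group
    have e3 : dist (g • x) (g ^ 2 • x) = dist x (g • x) := by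
      rw [dist_smul_smul_eq]; congr 2; group
    rw [e1, e2, e3] at h
    have e4 : n + 1 + 1 = n + 2 := rfl
    rw [e4]
    rcases max_choice (dist x (g • x) + dist x (g ^ n • x))
      (dist x (g ^ (n + 2) • x) + dist x (g • x)) with h' | h' <;> rw [h'] at h <;> linarith

lemma dist_pow_smul_add_le {δ : ℝ} (hδ : IsHyperbolicityConstant X δ) {g : H} {x : X}
    (hg : dist x (g • x) + 2 * δ + 1 ≤ dist x (g ^ 2 • x)) (n k : ℕ) :
    dist x (g ^ n • x) + k ≤ dist x (g ^ (n + k) • x) := by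
  induction k with
  | zero => simp
  | succ k ih =>
    rw [← add_assoc]
    push_cast
    linarith [dist_pow_smul_step hδ hg (n + k)]

lemma dist_zpow_smul (g : H) (x : X) (m n : ℤ) :
    dist (g ^ m • x) (g ^ n • x) = dist x (g ^ (m - n).natAbs • x) := by
  rw [dist_smul_smul_eq, ← zpow_neg, ← zpow_add]
  rcases le_total m n with h | h
  · rw [← zpow_natCast]; congr 3; omega
  · rw [← dist_inv_smul, ← zpow_neg, ← zpow_natCast]; congr 3; omega

lemma isLoxodromic_of_dist_sq {δ : ℝ} (hδ : IsHyperbolicityConstant X δ) {g : H} {x : X}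
    (hg : dist x (g • x) + 2 * δ + 1 ≤ dist x (g ^ 2 • x)) : IsLoxodromic X g := by
  have h1 : 1 ≤ dist x (g • x) := by simpa using dist_pow_smul_step hδ hg 0
  refine ⟨x, dist x (g • x), h1, 0, le_rfl, fun m n => ?_⟩
  have hlow := dist_pow_smul_add_le hδ hg 0 (m - n).natAbs
  have hup := dist_pow_smul_le g x (m - n).natAbs
  have e : (((m - n).natAbs : ℕ) : ℝ) = |(m : ℝ) - n| := by
    rw [Nat.cast_natAbs]; push_cast; rfl
  rw [zero_add, e] at hlow
  rw [e] at hup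
  rw [dist_zpow_smul]
  have hinv : (dist x (g • x))⁻¹ * |(m : ℝ) - n| ≤ 1 * |(m : ℝ) - n| :=
    mul_le_mul_of_nonneg_right (inv_le_one_of_one_le₀ h1) (abs_nonneg _)
  constructor
  · linarith [dist_nonneg (x := x) (y := g ^ 0 • x)]
  · linarith

lemma closeAtInfinity_pow_smul {δ : ℝ} (hδ : IsHyperbolicityConstant X δ) {g : H} {x : X}
    (hg : dist x (g • x) + 2 * δ + 1 ≤ dist x (g ^ 2 • x)) :
    CloseAtInfinity (fun n : ℕ => g ^ n • x) (fun n => g ^ n • x) := by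
  refine closeAtInfinity_of_base x fun M => ?_
  have key : ∀ m k : ℕ, (m : ℝ) / 2 ≤ gromovProduct x (g ^ m • x) (g ^ (m + k) • x) := by
    intro m k
    rw [gromovProduct_smul_smul, pow_add, inv_mul_cancel_left, ← pow_add, add_comm m k]
    linarith [dist_pow_smul_add_le hδ hg k m, dist_nonneg (x := x) (y := g ^ m • x)]
  obtain ⟨N, hN⟩ := exists_nat_ge (2 * M)
  refine ⟨N, fun m n hm hn => ?_⟩
  rcases le_total m n with h | h
  · obtain ⟨k, rfl⟩ := Nat.exists_eq_add_of_le h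
    have : (N : ℝ) ≤ m := by exact_mod_cast hm
    linarith [key m k]
  · obtain ⟨k, rfl⟩ := Nat.exists_eq_add_of_le h
    have : (N : ℝ) ≤ n := by exact_mod_cast hn
    rw [gromovProduct_comm]
    linarith [key n k]

omit [IsIsometricSMul H X] in
/-- Some power of a loxodromic isometry satisfies the hypothesis of `dist_pow_smul_step`. -/
lemma IsLoxodromic.exists_pow_dist_sq {g : H} (hg : IsLoxodromic X g) (δ : ℝ) :
    ∃ (x : X) (N : ℕ),
      dist x (g ^ N • x) + 2 * δ + 1 ≤ dist x ((g ^ N) ^ 2 • x) := by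
  obtain ⟨x, L, hL, C, -, h⟩ := hg
  refine ⟨x, ?_⟩
  by_contra! hcon
  -- otherwise the displacement of `g ^ (2 ^ n)` grows at most linearly in `n`
  have hup : ∀ n : ℕ, dist x (g ^ (2 ^ n) • x) ≤ dist x (g • x) + n * (2 * δ + 1) := by
    intro n
    induction n with
    | zero => simp
    | succ n ih =>
      have := hcon (2 ^ n)
      rw [← pow_mul, ← pow_succ] at this
      push_cast
      linarith
  have hlow : ∀ n : ℕ, L⁻¹ * 2 ^ n - C ≤ dist x (g ^ (2 ^ n) • x) := by
    intro n
    have := (h 0 ((2 ^ n : ℕ) : ℤ)).1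
    rw [zpow_natCast, zpow_zero, one_smul] at this
    simpa using this
  have hL0 : 0 < L⁻¹ := by positivity
  have hlim : Tendsto (fun n : ℕ => (n : ℝ) ^ 1 / (2 : ℝ) ^ n) atTop (nhds 0) :=
    tendsto_pow_const_div_const_pow_of_one_lt 1 one_lt_two
  have hlim' : Tendsto (fun n : ℕ => ((C + dist x (g • x)) * ((1 / 2 : ℝ) ^ n) +
      (2 * δ + 1) * ((n : ℝ) ^ 1 / (2 : ℝ) ^ n))) atTop (nhds 0) := by
    simpa using ((tendsto_pow_atTop_nhds_zero_of_lt_one (by norm_num : (0 : ℝ) ≤ 1 / 2)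
      (by norm_num)).const_mul (C + dist x (g • x))).add (hlim.const_mul (2 * δ + 1))
  obtain ⟨n, hn⟩ := (hlim'.eventually (gt_mem_nhds hL0)).exists
  have h2 : (0 : ℝ) < 2 ^ n := by positivity
  have h3 := mul_lt_mul_of_pos_right hn h2
  have e : (C + dist x (g • x)) * (1 / 2 : ℝ) ^ n + (2 * δ + 1) * ((n : ℝ) ^ 1 / (2 : ℝ) ^ n) =
      (C + dist x (g • x) + n * (2 * δ + 1)) / 2 ^ n := by
    rw [one_div, inv_pow]; field_simp
  rw [e, div_mul_cancel₀ _ h2.ne'] at h3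
  linarith [hup n, hlow n]

lemma IsLoxodromic.exists_pow_closeAtInfinity [GromovHyperbolic X] {g : H}
    (hg : IsLoxodromic X g) :
    ∃ (x : X) (N : ℕ),
      CloseAtInfinity (fun n : ℕ => (g ^ N) ^ n • x) (fun n => (g ^ N) ^ n • x) := by
  obtain ⟨δ, hδ⟩ := exists_isHyperbolicityConstant X
  obtain ⟨x, N, h⟩ := hg.exists_pow_dist_sq δ
  exact ⟨x, N, closeAtInfinity_pow_smul hδ h⟩

/-! ### Groups without loxodromic elements -/

lemma le_gromovProduct_inv_of_not_isLoxodromic {δ : ℝ} (hδ : IsHyperbolicityConstant X δ) {g : H}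
    (hg : ¬ IsLoxodromic X g) (x : X) :
    (dist x (g • x) - 2 * δ - 1) / 2 ≤ gromovProduct x (g⁻¹ • x) (g • x) := by
  have h : dist x (g ^ 2 • x) < dist x (g • x) + 2 * δ + 1 := by
    by_contra! h
    exact hg (isLoxodromic_of_dist_sq hδ h)
  rw [gromovProduct_smul_smul, inv_inv, ← pow_two, dist_inv_smul]
  linarith

lemma le_gromovProduct_of_no_loxodromic {δ : ℝ} (hδ : IsHyperbolicityConstant X δ) {L : Subgroup H}
    (hL : ∀ g ∈ L, ¬ IsLoxodromic X g) (x : X) {M : ℝ} {g h : H} (hg : g ∈ L)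
    (hh : h ∈ L) (hgN : 2 * M + 8 * δ + 1 ≤ dist x (g • x))
    (hhN : 2 * M + 8 * δ + 1 ≤ dist x (h • x)) :
    M ≤ gromovProduct x (g • x) (h • x) := by
  have h0 := hδ.1
  by_contra! hlt
  have ag := le_gromovProduct_inv_of_not_isLoxodromic hδ (hL g hg) x
  have ah := le_gromovProduct_inv_of_not_isLoxodromic hδ (hL h hh) x
  have agh := le_gromovProduct_inv_of_not_isLoxodromic hδ (hL _ (mul_mem hg hh)) x
  have trans : ∀ {a b c : X} {R : ℝ}, R + δ ≤ gromovProduct x a b → R + δ ≤ gromovProduct x b c →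
      R ≤ gromovProduct x a c := fun {a b c R} h1 h2 => by
    linarith [hδ.2 x a b c, le_min h1 h2]
  -- `g x` and `g⁻¹ x` are close at infinity, so `g⁻¹ x` diverges from `h x` as well, and `|g h|`
  -- is almost `|g| + |h|`
  have b1 : gromovProduct x (g⁻¹ • x) (h • x) < M + δ := by
    by_contra! hc
    refine absurd (trans (a := g • x) (b := g⁻¹ • x) (c := h • x) (R := M) ?_ hc) (not_le.2 hlt)
    rw [gromovProduct_comm]
    linarith
  rw [gromovProduct_smul_smul, inv_inv, dist_inv_smul] at b1
  have b2 : M + 3 * δ ≤ gromovProduct x (g • x) ((g * h) • x) := by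
    rw [gromovProduct_smul_smul, inv_mul_cancel_left]
    linarith
  have b3 : M + 3 * δ ≤ gromovProduct x ((g * h)⁻¹ • x) (h⁻¹ • x) := by
    rw [gromovProduct_smul_smul, inv_inv, mul_assoc, mul_inv_cancel, mul_one, dist_inv_smul,
      dist_inv_smul]
    linarith
  -- chain `g x`, `g h x`, `(g h)⁻¹ x`, `h⁻¹ x`, `h x`
  rw [gromovProduct_comm] at agh
  have c1 : M + 2 * δ ≤ gromovProduct x (g • x) ((g * h)⁻¹ • x) :=
    trans (by linarith) (by linarith)
  have c2 : M + δ ≤ gromovProduct x (g • x) (h⁻¹ • x) := trans (by linarith) (by linarith)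
  exact absurd (trans (R := M) (by linarith) (by linarith)) (not_le.2 hlt)

omit [IsIsometricSMul H X] in
lemma exists_seq_dist_ge {L : Subgroup H} {x : X} (h : ∀ D : ℝ, ∃ g ∈ L, D < dist x (g • x)) :
    ∃ g : ℕ → H, (∀ n, g n ∈ L) ∧ ∀ n : ℕ, (n : ℝ) ≤ dist x (g n • x) := by
  choose f hf hf' using h
  exact ⟨fun n => f n, fun n => hf n, fun n => (hf' n).le⟩

/-- A group without loxodromic elements and with an unbounded orbit fixes the limit of a sequence
in this orbit. -/
lemma exists_fixed_limit_of_no_loxodromic [GromovHyperbolic X] {L : Subgroup H}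
    (hL : ∀ g ∈ L, ¬ IsLoxodromic X g)
    {x : X} (h : ∀ D : ℝ, ∃ g ∈ L, D < dist x (g • x)) :
    ∃ g : ℕ → H, (∀ n, g n ∈ L) ∧
      ∃ hg : CloseAtInfinity (fun n => g n • x) (fun n => g n • x),
        ∀ f ∈ L, f • boundaryLimit hg = boundaryLimit hg := by
  obtain ⟨δ, hδ⟩ := exists_isHyperbolicityConstant X
  obtain ⟨g, hgL, hg⟩ := exists_seq_dist_ge h
  have key : ∀ f ∈ L, CloseAtInfinity (fun n => f • g n • x) (fun n => g n • x) := by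
    intro f hf
    refine closeAtInfinity_of_base x fun M => ?_
    obtain ⟨N, hN⟩ := exists_nat_ge (2 * M + 8 * δ + 1 + dist x (f • x))
    refine ⟨N, fun m n hm hn => ?_⟩
    have hm' : (N : ℝ) ≤ m := by exact_mod_cast hm
    have hn' : (N : ℝ) ≤ n := by exact_mod_cast hn
    rw [smul_smul]
    refine le_gromovProduct_of_no_loxodromic hδ hL x (mul_mem hf (hgL m))
      (hgL n) ?_ (by linarith [hg n, dist_nonneg (x := x) (y := f • x)])
    have := dist_mul_smul_le f⁻¹ (f * g m) x
    rw [inv_mul_cancel_left, dist_inv_smul] at this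
    linarith [hg m]
  have h1 : CloseAtInfinity (fun n => g n • x) (fun n => g n • x) := by
    simpa using key 1 L.one_mem
  exact ⟨g, hgL, h1, fun f hf => smul_boundaryLimit_eq h1 (key f hf)⟩

/-- A normal subgroup with bounded orbits displaces all points of an `H`-orbit by at most the same
amount, so it fixes the boundary points where this orbit accumulates. -/
lemma exists_fixed_of_normal_bounded [GromovHyperbolic X] {K : Subgroup H}
    (hK : K.Normal) {x : X} {D : ℝ}
    (hD : ∀ f ∈ K, dist x (f • x) ≤ D) (h : ∀ D : ℝ, ∃ g : H, D < dist x (g • x)) :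
    ∃ ξ : Boundary X, ∀ f ∈ K, f • ξ = ξ := by
  have bound : ∀ y : X, (∃ D : ℝ, ∀ f ∈ K, dist y (f • y) ≤ D) := fun y =>
    ⟨D + 2 * dist x y, fun f hf => by
      linarith [hD f hf, dist_triangle4 y x (f • x) (f • y), dist_smul f x y, dist_comm x y]⟩
  have main : ∀ (g : ℕ → H) (y : X),
      CloseAtInfinity (fun n => g n • y) (fun n => g n • y) →
        ∃ ξ : Boundary X, ∀ f ∈ K, f • ξ = ξ := by
    intro g y hg
    obtain ⟨D', hD'⟩ := bound y
    refine ⟨boundaryLimit hg, fun f hf =>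
      smul_boundaryLimit_eq_of_dist_le hg f (D := D') fun n => ?_⟩
    -- `f` moves `g n • y` as far as `(g n)⁻¹ * f * g n ∈ K` moves `y`
    rw [dist_comm, smul_smul, dist_smul_smul_eq, ← mul_assoc]
    simpa using hD' _ (hK.conj_mem f hf (g n)⁻¹)
  by_cases hlox : ∃ g : H, IsLoxodromic X g
  · obtain ⟨g, hg⟩ := hlox
    obtain ⟨y, N, hy⟩ := hg.exists_pow_closeAtInfinity
    exact main _ y hy
  · push Not at hlox
    obtain ⟨g, -, hg, -⟩ := exists_fixed_limit_of_no_loxodromic (L := (⊤ : Subgroup H))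
      (fun g _ => hlox g) (x := x) (fun D => (h D).imp fun g hg => ⟨trivial, hg⟩)
    exact main g x hg

end Isometries

/-! ### Subproducts -/

section Subproducts

variable {H : Type*} [Group H] {K : Subgroup H} {ι : Type*} {G : ι → Type*} [∀ i, Group (G i)]

lemma mem_subproduct {e : (∀ i, G i) ≃* K} {S : Set ι} {h : H} :
    h ∈ subproduct e S ↔ ∃ φ : ∀ i, G i, (∀ i ∉ S, φ i = 1) ∧ (e φ : H) = h := by
  simp [subproduct, Subgroup.mem_map, Subgroup.mem_pi]

lemma commute_of_mem_subproduct {e : (∀ i, G i) ≃* K} {S : Set ι} {g h : H}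
    (hg : g ∈ subproduct e S) (hh : h ∈ subproduct e Sᶜ) : Commute g h := by
  obtain ⟨φ, hφ, rfl⟩ := mem_subproduct.1 hg
  obtain ⟨ψ, hψ, rfl⟩ := mem_subproduct.1 hh
  have : φ * ψ = ψ * φ := by
    funext i
    by_cases hi : i ∈ S
    · simp [hψ i (by simpa using hi)]
    · simp [hφ i hi]
  have h2 := congrArg (fun a => (e a : H)) this
  simpa [Commute, SemiconjBy] using h2

lemma exists_mul_of_mem_subproduct_insert [DecidableEq ι] {e : (∀ i, G i) ≃* K} {S : Set ι}
    {j : ι} (hj : j ∉ S) {f : H} (hf : f ∈ subproduct e (insert j S)) :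
    ∃ a ∈ subproduct e {j}, ∃ b ∈ subproduct e S, f = a * b := by
  obtain ⟨φ, hφ, rfl⟩ := mem_subproduct.1 hf
  refine ⟨_, mem_subproduct.2 ⟨Pi.mulSingle j (φ j), fun i hi => ?_, rfl⟩, _,
    mem_subproduct.2 ⟨Function.update φ j 1, fun i hi => ?_, rfl⟩, ?_⟩
  · exact Pi.mulSingle_eq_of_ne hi _
  · by_cases hij : i = j
    · subst hij; simp
    · rw [Function.update_of_ne hij]
      exact hφ i (by simp [hij, hi])
  · rw [← Subgroup.coe_mul, ← map_mul]
    congr 2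
    funext i
    by_cases hij : i = j
    · subst hij; simp
    · simp [hij]

lemma mem_subproduct_univ {e : (∀ i, G i) ≃* K} {f : H} (hf : f ∈ K) :
    f ∈ subproduct e Set.univ :=
  mem_subproduct.2 ⟨e.symm ⟨f, hf⟩, fun i hi => absurd (Set.mem_univ i) hi, by simp⟩

lemma exists_dist_le_of_subproduct {X : Type*} [MetricSpace X] [MulAction H X]
    [IsIsometricSMul H X] {e : (∀ i, G i) ≃* K} {x : X}
    (h : ∀ j, ∃ D : ℝ, ∀ f ∈ subproduct e {j}, dist x (f • x) ≤ D) (s : Finset ι) :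
    ∃ D : ℝ, ∀ f ∈ subproduct e (s : Set ι), dist x (f • x) ≤ D := by
  classical
  induction s using Finset.induction_on with
  | empty =>
    refine ⟨0, fun f hf => ?_⟩
    obtain ⟨φ, hφ, rfl⟩ := mem_subproduct.1 hf
    have : φ = 1 := funext fun i => hφ i (by simp)
    simp [this]
  | insert j s hj ih =>
    obtain ⟨D, hD⟩ := ih
    obtain ⟨D', hD'⟩ := h j
    refine ⟨D' + D, fun f hf => ?_⟩
    rw [Finset.coe_insert] at hf
    obtain ⟨a, ha, b, hb, rfl⟩ := exists_mul_of_mem_subproduct_insert (by simpa using hj) hf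
    exact (dist_mul_smul_le a b x).trans (add_le_add (hD' a ha) (hD b hb))

end Subproducts

end GromovHyp

open GromovHyp in
theorem proposition3p2 {X : Type*} [MetricSpace X] [GromovHyp.GromovHyperbolic X]
    (hX : GromovHyp.IsGeodesicSpace X)
    {H : Type*} [Group H] [MulAction H X] [IsIsometricSMul H X]
    (K : Subgroup H) (hK : K.Normal)
    (k : ℕ) (G : Fin k → Type*) [∀ i, Group (G i)] (e : (∀ i, G i) ≃* K) :
    (∀ j : Fin k, (∃ g ∈ GromovHyp.subproduct e {j}, GromovHyp.IsLoxodromic X g) →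
      GromovHyp.HasFiniteOrbitAtInfinity (GromovHyp.subproduct e {j}ᶜ) X) ∧
    ((∀ j : Fin k, ¬ ∃ g ∈ GromovHyp.subproduct e {j}, GromovHyp.IsLoxodromic X g) →
      GromovHyp.HasFiniteOrbitAtInfinity K X ∨ GromovHyp.HasBoundedOrbits H X) := by
  constructor
  · rintro j ⟨g, hg, hlox⟩
    obtain ⟨x, N, hx⟩ := hlox.exists_pow_closeAtInfinity
    exact .of_fixed (boundaryLimit hx) fun f hf => smul_boundaryLimit_eq_of_commute hx fun n =>
      (commute_of_mem_subproduct (pow_mem (pow_mem hg N) n) hf).symm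
  · intro hlox
    rw [or_iff_not_imp_right]
    intro hH
    obtain ⟨x, hx⟩ : ∃ x : X, ¬ Bornology.IsBounded (MulAction.orbit H x) := by
      simpa [HasBoundedOrbits] using hH
    have hunb : ∀ D : ℝ, ∃ g : H, D < dist x (g • x) := by
      by_contra! hcon
      obtain ⟨D, hD⟩ := hcon
      refine hx (Metric.isBounded_closedBall.subset (?_ : _ ⊆ Metric.closedBall x D))
      rintro _ ⟨g, rfl⟩
      rw [Metric.mem_closedBall, dist_comm]
      exact hD g
    by_cases hb : ∀ j, ∃ D : ℝ, ∀ f ∈ subproduct e {j}, dist x (f • x) ≤ D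
    · obtain ⟨D, hD⟩ := exists_dist_le_of_subproduct hb Finset.univ
      rw [Finset.coe_univ] at hD
      obtain ⟨ξ, hξ⟩ := exists_fixed_of_normal_bounded hK
        (fun f hf => hD f (mem_subproduct_univ hf)) hunb
      exact .of_fixed ξ hξ
    · push Not at hb
      obtain ⟨j, hj⟩ := hb
      obtain ⟨g, hgL, hg, hfix⟩ := exists_fixed_limit_of_no_loxodromic
        (fun g hg hl => hlox j ⟨g, hg, hl⟩) hj
      refine .of_fixed (boundaryLimit hg) fun f hf => ?_
      have hf' : f ∈ subproduct e (insert j {j}ᶜ) := by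
        rw [Set.insert_eq, Set.union_compl_self]
        exact mem_subproduct_univ hf
      obtain ⟨a, ha, b, hbj, rfl⟩ := exists_mul_of_mem_subproduct_insert (by simp) hf'
      rw [mul_smul, smul_boundaryLimit_eq_of_commute hg fun n =>
        (commute_of_mem_subproduct (hgL n) hbj).symm]
      exact hfix a ha
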